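/- Let $a>0$ and $\alpha>0$ be real. For $r,\rho>a$ put $$R(\rho)=\Big(\frac{\rho}{a}\Big)^{\frac{\pi}{2\alpha}}+\Big(\frac{\rho}{a}\Big)^{-\frac{\pi}{2\alpha}},\qquad G(r)=\frac{\pi}{\alpha}\ln\frac{r}{a}-\ln 4 ,$$ and for $k\in\mathbb C$, $-\alpha<\varphi<\alpha$ and $\rho>a$ put $$\begin{aligned}F_1(\varphi,k)={}&k\int_{-\alpha}^{\alpha}\cos(k\theta)\,\ln\Big|\sin\frac{\pi\varphi}{2\alpha}+\sin\frac{\pi\theta}{2\alpha}\Big|\,d\theta\\&+k\sin(\alpha k)\int_a^\infty\Big(\frac ra\Big)^k\Big[\ln\Big|\frac{R(r)^2}{4}-\sin^2\frac{\pi\varphi}{2\alpha}\Big|-G(r)\Big]\frac{dr}{r}-\pi\cos(k\varphi),\\F_2(\rho,k)={}&k\int_{-\alpha}^{\alpha}\cos(k\theta)\,\ln\Big|\frac{R(\rho)}2+\sin\frac{\pi\theta}{2\alpha}\Big|\,d\theta\\&+k\sin(\alpha k)\int_a^\infty\Big(\frac ra\Big)^k\Big[\ln\Big|\frac{R(r)^2}{4}-\frac{R(\rho)^2}{4}\Big|-G(r)\Big]\frac{dr}{r}-\pi\cos(\alpha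 k)\Big(\frac{\rho}{a}\Big)^k .\end{aligned}$$ Let $\kappa\in\mathbb C$ with $\operatorname{Re}\kappa>-1$ and $k=-\frac{\pi\kappa}{2\alpha}$ (so $\operatorname{Re}k<\frac{\pi}{2\alpha}$). Then, for all $\varphi\in(-\alpha,\alpha)$ and all $\rho\in(a,\infty)$, the four integrals converge absolutely and, if $k\neq0$, $$F_1(\varphi,k)=F_2(\rho,k)=-\sin(\alpha k)\Big[2\ln 2+\frac{\pi}{\alpha k}\Big];$$ in particular $F_1$ and $F_2$ do not depend on $\varphi$ and $\rho$. If $k=0$, then $F_1(\varphi,0)=F_2(\rho,0)=-\pi$, which is the limit of the right-hand side as $k\to0$. -/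

import Mathlib

open Set MeasureTheory

namespace NeumannWedge

/-- `R(ρ) = (ρ/a)^{π/(2α)} + (ρ/a)^{-π/(2α)}`. -/
noncomputable def R (a α ρ : ℝ) : ℝ :=
  (ρ / a) ^ (Real.pi / (2 * α)) + (ρ / a) ^ (-(Real.pi / (2 * α)))

/-- `G(r) = (π/α) ln(r/a) - ln 4`, the large-`r` behaviour of `ln |R(r)²/4 + c|`. -/
noncomputable def G (a α r : ℝ) : ℝ :=
  Real.pi / α * Real.log (r / a) - Real.log 4

/-- The angular integrand `cos(kθ) ln |sin(πφ/(2α)) + sin(πθ/(2α))|` in `F₁(φ, k)`. -/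
noncomputable def angular₁ (α φ : ℝ) (k : ℂ) (θ : ℝ) : ℂ :=
  Complex.cos (k * θ) *
    (Real.log |Real.sin (Real.pi * φ / (2 * α)) + Real.sin (Real.pi * θ / (2 * α))| : ℝ)

/-- The radial integrand `(r/a)^k [ln |R(r)²/4 - sin²(πφ/(2α))| - G(r)] / r` in `F₁(φ, k)`. -/
noncomputable def radial₁ (a α φ : ℝ) (k : ℂ) (r : ℝ) : ℂ :=
  ((r / a : ℝ) : ℂ) ^ k *
    ((Real.log |R a α r ^ 2 / 4 - Real.sin (Real.pi * φ / (2 * α)) ^ 2| - G a α r : ℝ) : ℂ) / r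

/-- The angular integrand `cos(kθ) ln |R(ρ)/2 + sin(πθ/(2α))|` in `F₂(ρ, k)`. -/
noncomputable def angular₂ (a α ρ : ℝ) (k : ℂ) (θ : ℝ) : ℂ :=
  Complex.cos (k * θ) *
    (Real.log |R a α ρ / 2 + Real.sin (Real.pi * θ / (2 * α))| : ℝ)

/-- The radial integrand `(r/a)^k [ln |R(r)²/4 - R(ρ)²/4| - G(r)] / r` in `F₂(ρ, k)`. -/
noncomputable def radial₂ (a α ρ : ℝ) (k : ℂ) (r : ℝ) : ℂ :=
  ((r / a : ℝ) : ℂ) ^ k *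
    ((Real.log |R a α r ^ 2 / 4 - R a α ρ ^ 2 / 4| - G a α r : ℝ) : ℂ) / r

/-- The function `F₁(φ, k)`, for `-α < φ < α`. -/
noncomputable def F₁ (a α φ : ℝ) (k : ℂ) : ℂ :=
  k * (∫ θ in (-α)..α, angular₁ α φ k θ)
    + k * Complex.sin (α * k) * (∫ r in Ioi a, radial₁ a α φ k r)
    - Real.pi * Complex.cos (k * φ)

/-- The function `F₂(ρ, k)`, for `a < ρ`. -/
noncomputable def F₂ (a α ρ : ℝ) (k : ℂ) : ℂ :=
  k * (∫ θ in (-α)..α, angular₂ a α ρ k θ)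
    + k * Complex.sin (α * k) * (∫ r in Ioi a, radial₂ a α ρ k r)
    - Real.pi * Complex.cos (α * k) * ((ρ / a : ℝ) : ℂ) ^ k

end NeumannWedge

/-! With `b = π/(2α)`, the substitutions `ψ = bθ`, `r = a exp(s/b)`, `k = bm` remove `a` and `α`:
the angular integral runs over `[-π/2, π/2]`, the radial one over `s > 0`, `R/2` becomes `cosh s`,
and `αk = mπ/2`.

Everything is then expanded in the coefficients `c_n` of `cos (mψ)` against `cos (2nψ)`. The angular
logarithm has a Fourier series with coefficients of order `1/n`, which produces multiples of `c_n /
n`. The radial logarithm, with its growth `2s - ln 4` removed, is a series of exponentials that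
integrates to multiples of `1/(n(2n - m))`. The identity `(m² - 4n²) c_n = 2m sin(mπ/2) (-1)^n`
(`cosCoeff_identity`) rewrites the radial prefactor through `c_n` and cancels that denominator. The
two series add up to `2 Σ c_n cos(2nφ)`, which is `π cos(mφ) - c_0` by Fourier inversion
(`hasSum_cosCoeff`). Only `c_0 = 2 sin(mπ/2)/m` survives, hence the constant value.

For `F₂` the same cancellation yields `exp(mσ)` times the cosine series at `π/2`, where `ρ = a
exp(σ/b)`; the radial integral is split at its singularity `s = σ`. -/

namespace NeumannWedge

open Filter Topology

/-! ### Cosine series of `cos (mψ)` with period `π` -/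

/-- The cosine coefficients of `ψ ↦ cos (m ψ)` on `[-π/2, π/2]`. -/
noncomputable def cosCoeff (m : ℂ) (n : ℕ) : ℂ :=
  ∫ ψ in (-(Real.pi / 2))..(Real.pi / 2), Complex.cos (m * ψ) * Complex.cos (2 * n * ψ)

/-- The integrand times `m² - 4n²` is an exact derivative. The factor is not divided out, since `m =
±2n` is not excluded. -/
lemma cosCoeff_identity (m : ℂ) (n : ℕ) :
    (m ^ 2 - 4 * n ^ 2) * cosCoeff m n
      = 2 * m * Complex.sin (m * (Real.pi / 2)) * (-1) ^ n := by
  have hderiv : ∀ x ∈ uIcc (-(Real.pi / 2)) (Real.pi / 2), HasDerivAt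
      (fun ψ : ℝ => m * Complex.sin (m * ψ) * Complex.cos (2 * n * ψ)
        - 2 * n * (Complex.cos (m * ψ) * Complex.sin (2 * n * ψ)))
      ((m ^ 2 - 4 * n ^ 2) * (Complex.cos (m * x) * Complex.cos (2 * n * x))) x := by
    intro x _
    have hid := hasDerivAt_id' (x : ℂ)
    have h1 := (hid.const_mul m).ccos
    have h2 := (hid.const_mul m).csin
    have h3 := (hid.const_mul (2 * (n : ℂ))).ccos
    have h4 := (hid.const_mul (2 * (n : ℂ))).csin
    refine (((h2.const_mul m).mul h3).sub ((h1.mul h4).const_mul (2 * (n : ℂ)))).comp_ofReal.congr_deriv ?_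
    ring
  have hint := intervalIntegral.integral_eq_sub_of_hasDerivAt hderiv
    (Continuous.intervalIntegrable (by fun_prop) _ _)
  rw [intervalIntegral.integral_const_mul] at hint
  rw [cosCoeff, hint]
  have hs : Complex.sin (2 * n * (Real.pi / 2 : ℝ)) = 0 := by
    rw [show (2 * n * (Real.pi / 2 : ℝ) : ℂ) = n * Real.pi by push_cast; ring]
    exact Complex.sin_nat_mul_pi n
  have hc : Complex.cos (2 * n * (Real.pi / 2 : ℝ)) = (-1) ^ n := by
    rw [show (2 * n * (Real.pi / 2 : ℝ) : ℂ) = n * Real.pi by push_cast; ring]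
    exact_mod_cast congrArg Complex.ofReal (Real.cos_nat_mul_pi n)
  rw [Complex.ofReal_neg, mul_neg, mul_neg, Complex.sin_neg, Complex.sin_neg, Complex.cos_neg,
    Complex.cos_neg, hs, hc]
  push_cast
  ring

lemma cosCoeff_zero (m : ℂ) (hm : m ≠ 0) :
    cosCoeff m 0 = 2 * Complex.sin (m * (Real.pi / 2)) / m := by
  have h := cosCoeff_identity m 0
  rw [eq_div_iff hm]
  apply mul_left_cancel₀ hm
  simp at h
  linear_combination h

/-- The identity above gives decay of order `1/n²`: once `n ≥ ‖m‖`, the factor `m² - 4n²` has norm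
at least `3n²`. -/
lemma summable_norm_cosCoeff (m : ℂ) : Summable fun n : ℕ => ‖cosCoeff m n‖ := by
  set C := ‖2 * m * Complex.sin (m * (Real.pi / 2))‖
  refine Summable.of_norm_bounded_eventually_nat
    (g := fun n : ℕ => C * (1 / (n : ℝ) ^ 2)) ((Real.summable_one_div_nat_pow.2 one_lt_two).mul_left C) ?_
  obtain ⟨N, hN⟩ := exists_nat_gt ‖m‖
  filter_upwards [eventually_ge_atTop (N + 1)] with n hn
  have hn' : ‖m‖ ≤ n := hN.le.trans (by exact_mod_cast (Nat.le_succ N).trans hn)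
  have hn0 : (0 : ℝ) < n := by exact_mod_cast (Nat.succ_pos N).trans_le hn
  have h := congrArg norm (cosCoeff_identity m n)
  rw [norm_mul, norm_mul _ ((-1 : ℂ) ^ n), norm_pow, norm_neg, norm_one, one_pow, mul_one] at h
  have hlow : (n : ℝ) ^ 2 ≤ ‖m ^ 2 - 4 * n ^ 2‖ := by
    have h1 := norm_sub_norm_le (4 * (n : ℂ) ^ 2) (m ^ 2)
    rw [norm_sub_rev] at h1
    simp only [norm_mul, norm_pow, Complex.norm_natCast, Complex.norm_ofNat] at h1
    nlinarith [norm_nonneg m]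
  rw [norm_norm, mul_one_div, le_div_iff₀ (by positivity)]
  calc _ ≤ ‖cosCoeff m n‖ * ‖m ^ 2 - 4 * n ^ 2‖ := by gcongr
    _ = C := by rw [mul_comm, h]

lemma integral_odd_eq_zero {f : ℝ → ℂ} (c : ℝ) (hf : ∀ x, f (-x) = -f x) :
    ∫ x in (-c)..c, f x = 0 := by
  have h := intervalIntegral.integral_comp_neg (a := -c) (b := c) f
  simp only [hf, intervalIntegral.integral_neg, neg_neg] at h
  linear_combination (-1 / 2 : ℂ) * h

lemma fourierCoeff_cos [Fact (0 < Real.pi)] (m : ℂ) (n : ℤ) :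
    fourierCoeff (AddCircle.liftIco Real.pi (-(Real.pi / 2)) fun x : ℝ => Complex.cos (m * x)) n
      = cosCoeff m n.natAbs / Real.pi := by
  rw [fourierCoeff_liftIco_eq, fourierCoeffOn_eq_integral]
  have hb : -(Real.pi / 2) + Real.pi = Real.pi / 2 := by ring
  have hT : -(Real.pi / 2) + Real.pi - -(Real.pi / 2) = Real.pi := by ring
  have hcos : ∀ x : ℝ, Complex.cos (2 * n.natAbs * x) = Complex.cos (2 * n * x) := by
    intro x
    rcases Int.natAbs_eq n with h | h
    · conv_rhs => rw [h]
      simp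
    · conv_rhs => rw [h]
      simp
  have key : ∀ x : ℝ, (fourier (T := -(Real.pi / 2) + Real.pi - -(Real.pi / 2)) (-n)
        (x : AddCircle (-(Real.pi / 2) + Real.pi - -(Real.pi / 2)))) • Complex.cos (m * x)
      = Complex.cos (m * x) * Complex.cos (2 * n.natAbs * x)
        + -Complex.I * (Complex.cos (m * x) * Complex.sin (2 * n * x)) := by
    intro x
    rw [fourier_coe_apply, hcos, hT, smul_eq_mul]
    rw [show (2 * Real.pi * Complex.I * ((-n : ℤ) : ℂ) * x / (Real.pi : ℂ))
      = -(2 * n * x) * Complex.I by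
        have : (Real.pi : ℂ) ≠ 0 := by exact_mod_cast Real.pi_ne_zero
        field_simp
        push_cast
        ring]
    rw [Complex.exp_mul_I, Complex.cos_neg, Complex.sin_neg]
    ring
  simp_rw [key]
  rw [intervalIntegral.integral_add (Continuous.intervalIntegrable (by fun_prop) _ _)
    (Continuous.intervalIntegrable (by fun_prop) _ _), hb, intervalIntegral.integral_const_mul,
    integral_odd_eq_zero (f := fun x : ℝ => Complex.cos (m * x) * Complex.sin (2 * n * x))]
  · rw [cosCoeff, Complex.real_smul, mul_zero, add_zero]
    rw [show Real.pi / 2 - -(Real.pi / 2) = Real.pi by ring]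
    push_cast
    ring
  · intro x
    push_cast
    rw [mul_neg, mul_neg, Complex.cos_neg, Complex.sin_neg, mul_neg]

/-- The even function `cos (mψ)` agrees at `±π/2`, so its `π`-periodic extension is continuous, and
summable coefficients give pointwise convergence. The closed interval matters: the endpoint `π/2` is
the one used for `F₂`. The factor 2 pairs the frequencies `±n`. -/
lemma hasSum_cosCoeff (m : ℂ) {φ : ℝ} (hφ : φ ∈ Icc (-(Real.pi / 2)) (Real.pi / 2)) :
    HasSum (fun n : ℕ => 2 * (cosCoeff m (n + 1) * Complex.cos (2 * (n + 1) * φ)))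
      (Real.pi * Complex.cos (m * φ) - cosCoeff m 0) := by
  have : Fact (0 < Real.pi) := ⟨Real.pi_pos⟩
  have hpi : (Real.pi : ℂ) ≠ 0 := by exact_mod_cast Real.pi_ne_zero
  set f : ℝ → ℂ := fun x => Complex.cos (m * x) with hf
  have hper : f (-(Real.pi / 2)) = f (-(Real.pi / 2) + Real.pi) := by
    rw [show -(Real.pi / 2) + Real.pi = Real.pi / 2 by ring]
    simp [hf]
  let F : C(AddCircle Real.pi, ℂ) := ⟨AddCircle.liftIco Real.pi (-(Real.pi / 2)) f,
    AddCircle.liftIco_continuous hper (by fun_prop)⟩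
  have hcoe : ∀ n : ℤ, fourierCoeff F n = cosCoeff m n.natAbs / Real.pi := fourierCoeff_cos m
  have hsum : Summable (fourierCoeff F) := by
    have h1 : Summable fun n : ℕ => cosCoeff m n / Real.pi :=
      (summable_norm_cosCoeff m).of_norm.div_const _
    refine Summable.of_nat_of_neg ?_ ?_
    · simpa [hcoe] using h1
    · simpa [hcoe] using h1
  have hlift : ∀ {x : ℝ}, x ∈ Ico (-(Real.pi / 2)) (-(Real.pi / 2) + Real.pi) →
      F (x : AddCircle Real.pi) = f x := fun hx =>
    AddCircle.liftIco_coe_apply (f := f) hx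
  have hval : F (φ : AddCircle Real.pi) = f φ := by
    rcases hφ.2.lt_or_eq with h | h
    · exact hlift ⟨hφ.1, by linarith⟩
    · have h2 : ((φ : ℝ) : AddCircle Real.pi) = ((-(Real.pi / 2) : ℝ) : AddCircle Real.pi) := by
        rw [h, ← AddCircle.coe_add_period Real.pi (-(Real.pi / 2))]
        congr 1
        ring
      rw [h2, hlift ⟨le_rfl, by linarith [Real.pi_pos]⟩, hper, h]
      congr 1
      ring
  have hS := has_pointwise_sum_fourier_series_of_summable hsum (φ : AddCircle Real.pi)
  rw [hval] at hS
  have hnat := (hasSum_nat_add_iff' 1).2 hS.nat_add_neg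
  have hexp : ∀ j : ℤ, (fourier j (φ : AddCircle Real.pi) : ℂ)
      = Complex.exp (2 * j * φ * Complex.I) := by
    intro j
    rw [fourier_coe_apply]
    congr 1
    field_simp
  convert! hnat.mul_left (Real.pi : ℂ) using 1
  · funext n
    rw [hcoe, hcoe, hexp, hexp, Int.natAbs_neg, Int.natAbs_natCast, smul_eq_mul, smul_eq_mul,
      Complex.cos]
    push_cast
    field_simp
  · simp [hcoe, hf]
    field_simp

/-! ### Termwise integration and the logarithmic Fourier series -/

/-- Summable `L¹` norms give integrability of the sum as well as its integral, so absolute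
convergence and evaluation are obtained together. -/
lemma integrable_and_hasSum_integral {μ : Measure ℝ} {F : ℕ → ℝ → ℂ} {g : ℝ → ℂ}
    (hF : ∀ n, Integrable (F n) μ) (hsum : Summable fun n => ∫ x, ‖F n x‖ ∂μ)
    (hg : ∀ᵐ x ∂μ, HasSum (fun n => F n x) (g x)) :
    Integrable g μ ∧ HasSum (fun n => ∫ x, F n x ∂μ) (∫ x, g x ∂μ) := by
  refine ⟨⟨?_, ?_⟩, ?_⟩
  · refine aestronglyMeasurable_of_tendsto_ae atTop
      (f := fun N x => ∑ n ∈ Finset.range N, F n x) (fun N => ?_) ?_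
    · exact (integrable_finsetSum _ fun n _ => hF n).aestronglyMeasurable
    · filter_upwards [hg] with x hx using hx.tendsto_sum_nat
  · rw [hasFiniteIntegral_iff_enorm]
    calc ∫⁻ x, ‖g x‖ₑ ∂μ ≤ ∫⁻ x, ∑' n, ‖F n x‖ₑ ∂μ := by
          refine lintegral_mono_ae ?_
          filter_upwards [hg] with x hx
          rw [← hx.tsum_eq]
          exact enorm_tsum_le_tsum_enorm
      _ = ∑' n, ∫⁻ x, ‖F n x‖ₑ ∂μ := lintegral_tsum fun n => (hF n).1.enorm
      _ = ∑' n, ENNReal.ofReal (∫ x, ‖F n x‖ ∂μ) := by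
          simp_rw [ofReal_integral_norm_eq_lintegral_enorm (hF _)]
      _ < ⊤ := by
          rw [← ENNReal.ofReal_tsum_of_nonneg (fun n => integral_nonneg fun x => norm_nonneg _) hsum]
          exact ENNReal.ofReal_lt_top
  · have h := hasSum_integral_of_summable_integral_norm hF hsum
    rwa [integral_congr_ae (hg.mono fun x hx => hx.tsum_eq)] at h

lemma one_sub_two_mul_cos_add_sq_pos {r : ℝ} (hr : |r| < 1) (t : ℝ) :
    0 < 1 - 2 * r * Real.cos t + r ^ 2 := by
  have h1 : 0 < (1 - |r|) ^ 2 := by have : 0 < 1 - |r| := by linarith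
                                    positivity
  have h2 : r * Real.cos t ≤ |r| := by
    calc r * Real.cos t ≤ |r * Real.cos t| := le_abs_self _
      _ = |r| * |Real.cos t| := abs_mul _ _
      _ ≤ |r| * 1 := by gcongr; exact Real.abs_cos_le_one t
      _ = |r| := mul_one _
  nlinarith [sq_abs r]

/-- The Fourier expansion of `log |1 - r exp (it)|`. -/
lemma hasSum_log_one_sub_two_mul_cos {r : ℝ} (hr : |r| < 1) (t : ℝ) :
    HasSum (fun n : ℕ => -(r ^ (n + 1) / (n + 1)) * Real.cos ((n + 1) * t))
      (1 / 2 * Real.log (1 - 2 * r * Real.cos t + r ^ 2)) := by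
  have hz : ‖(r : ℂ) * Complex.exp (t * Complex.I)‖ < 1 := by
    rwa [norm_mul, Complex.norm_exp_ofReal_mul_I, mul_one, Complex.norm_real]
  have h := Complex.hasSum_re (Complex.hasSum_taylorSeries_neg_log hz)
  have h' := ((hasSum_nat_add_iff' 1).2 h).neg
  convert! h' using 1
  · funext n
    rw [mul_pow, ← Complex.exp_nat_mul, ← Complex.ofReal_pow, ← mul_assoc, ← Complex.ofReal_natCast,
      ← Complex.ofReal_mul, Complex.div_ofReal_re, Complex.re_ofReal_mul,
      Complex.exp_ofReal_mul_I_re]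
    push_cast
    ring
  · simp only [Finset.sum_range_one, Complex.neg_re, Complex.log_re, pow_zero, Nat.cast_zero,
      div_zero, Complex.zero_re, sub_zero, neg_neg]
    rw [Complex.norm_def, Real.log_sqrt (Complex.normSq_nonneg _), Complex.normSq_apply]
    have hre : (1 - (r : ℂ) * Complex.exp (t * Complex.I)).re = 1 - r * Real.cos t := by
      rw [Complex.sub_re, Complex.re_ofReal_mul, Complex.exp_ofReal_mul_I_re, Complex.one_re]
    have him : (1 - (r : ℂ) * Complex.exp (t * Complex.I)).im = - (r * Real.sin t) := by
      rw [Complex.sub_im, Complex.im_ofReal_mul, Complex.exp_ofReal_mul_I_im, Complex.one_im]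
      ring
    rw [hre, him, one_div_mul_eq_div]
    congr 2
    nlinarith [Real.sin_sq_add_cos_sq t]

/-! ### Angular integrals as series in `cosCoeff` -/

lemma integral_cos_mul_cos_shift (m : ℂ) (φ : ℝ) (n : ℕ) :
    ∫ ψ in (-(Real.pi / 2))..(Real.pi / 2),
        Complex.cos (m * ψ) * Complex.cos (n * (2 * (φ + ψ)))
      = Complex.cos (2 * n * φ) * cosCoeff m n := by
  have key : ∀ ψ : ℝ, Complex.cos (m * ψ) * Complex.cos (n * (2 * (φ + ψ)))
      = Complex.cos (2 * n * φ) * (Complex.cos (m * ψ) * Complex.cos (2 * n * ψ))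
        - Complex.sin (2 * n * φ) * (Complex.cos (m * ψ) * Complex.sin (2 * n * ψ)) := by
    intro ψ
    rw [show (n * (2 * (φ + ψ)) : ℂ) = 2 * n * φ + 2 * n * ψ by ring, Complex.cos_add]
    ring
  simp_rw [key]
  rw [intervalIntegral.integral_sub (Continuous.intervalIntegrable (by fun_prop) _ _)
    (Continuous.intervalIntegrable (by fun_prop) _ _), intervalIntegral.integral_const_mul,
    intervalIntegral.integral_const_mul,
    integral_odd_eq_zero (f := fun x : ℝ => Complex.cos (m * x) * Complex.sin (2 * n * x)),
    mul_zero, sub_zero, cosCoeff]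
  intro x
  push_cast
  rw [mul_neg, mul_neg, Complex.cos_neg, Complex.sin_neg, mul_neg]

lemma hasSum_integral_cos_mul_log {r : ℝ} (hr : |r| < 1) (m : ℂ) (φ : ℝ) :
    HasSum (fun n : ℕ => -((r : ℂ) ^ (n + 1) / (n + 1))
        * (Complex.cos (2 * (n + 1) * φ) * cosCoeff m (n + 1)))
      (∫ ψ in (-(Real.pi / 2))..(Real.pi / 2), Complex.cos (m * ψ)
        * ((1 / 2 * Real.log (1 - 2 * r * Real.cos (2 * (φ + ψ)) + r ^ 2) : ℝ) : ℂ)) := by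
  have hcont : Continuous fun ψ : ℝ => Complex.cos (m * ψ) := by fun_prop
  obtain ⟨C, hC⟩ := isCompact_uIcc.exists_bound_of_continuousOn
    (s := uIcc (-(Real.pi / 2)) (Real.pi / 2)) hcont.continuousOn
  have hgeom : Summable fun n : ℕ => C * |r| ^ (n + 1) :=
    ((summable_nat_add_iff 1).2 (summable_geometric_of_lt_one (abs_nonneg r) hr)).mul_left C
  have h := intervalIntegral.hasSum_integral_of_dominated_convergence
    (F := fun (n : ℕ) (ψ : ℝ) => Complex.cos (m * ψ)
      * ((-(r ^ (n + 1) / (n + 1)) * Real.cos ((n + 1) * (2 * (φ + ψ))) : ℝ) : ℂ))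
    (f := fun ψ : ℝ => Complex.cos (m * ψ)
        * ((1 / 2 * Real.log (1 - 2 * r * Real.cos (2 * (φ + ψ)) + r ^ 2) : ℝ) : ℂ))
    (a := -(Real.pi / 2)) (b := Real.pi / 2) (μ := volume)
    (fun n _ => C * |r| ^ (n + 1)) ?_ ?_ ?_ ?_ ?_
  · convert! h using 1
    funext n
    have h1 := integral_cos_mul_cos_shift m φ (n + 1)
    push_cast at h1
    rw [← h1, ← intervalIntegral.integral_const_mul]
    refine intervalIntegral.integral_congr fun ψ _ => ?_
    push_cast
    ring
  · intro n
    refine Continuous.aestronglyMeasurable ?_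
    fun_prop
  · refine fun n => ae_of_all _ fun ψ hψ => ?_
    have h1 : (1 : ℝ) ≤ n + 1 := by linarith [Nat.cast_nonneg (α := ℝ) n]
    have h2 := hC ψ (uIoc_subset_uIcc hψ)
    rw [norm_mul, Complex.norm_real, Real.norm_eq_abs, abs_mul, abs_neg, abs_div, abs_pow,
      abs_of_pos (by linarith : (0 : ℝ) < n + 1)]
    have h3 : |r| ^ (n + 1) / (n + 1) * |Real.cos ((n + 1) * (2 * (φ + ψ)))| ≤ |r| ^ (n + 1) := by
      calc _ ≤ |r| ^ (n + 1) / 1 * 1 := by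
            gcongr
            exact Real.abs_cos_le_one _
        _ = _ := by ring
    exact mul_le_mul h2 h3 (by positivity) ((norm_nonneg _).trans h2)
  · exact ae_of_all _ fun _ _ => hgeom
  · exact intervalIntegrable_const
  · refine ae_of_all _ fun ψ _ => ?_
    exact (Complex.hasSum_ofReal.2 (hasSum_log_one_sub_two_mul_cos hr (2 * (φ + ψ)))).mul_left _

lemma intervalIntegrable_log_abs {f : ℝ → ℝ} (hf : ∀ x, AnalyticAt ℝ f x) (a b : ℝ) :
    IntervalIntegrable (fun x => Real.log |f x|) volume a b := by
  simp_rw [Real.log_abs]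
  exact MeromorphicOn.intervalIntegrable_log fun x _ => (hf x).meromorphicAt

lemma intervalIntegrable_cos_mul {f : ℝ → ℝ} {a b : ℝ} (m : ℂ)
    (hf : IntervalIntegrable f volume a b) :
    IntervalIntegrable (fun x => Complex.cos (m * x) * (f x : ℂ)) volume a b := by
  refine IntervalIntegrable.continuousOn_mul (f := fun x => (f x : ℂ)) ?_
    (Continuous.continuousOn (by fun_prop))
  exact ⟨hf.1.ofReal, hf.2.ofReal⟩

lemma ae_sin_add_ne_zero (φ : ℝ) : ∀ᵐ ψ : ℝ, Real.sin (φ + ψ) ≠ 0 := by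
  have hsub : {ψ : ℝ | ¬ Real.sin (φ + ψ) ≠ 0} ⊆ range fun n : ℤ => n * Real.pi - φ := by
    intro ψ hψ
    obtain ⟨n, hn⟩ := Real.sin_eq_zero_iff.1 (not_not.1 hψ)
    exact ⟨n, by simp only [hn]; ring⟩
  exact ((countable_range _).mono hsub).measure_zero _

/-- This is the boundary case `r = 1`, where the geometric domination fails. It follows by letting
`r → 1⁻`: the series is dominated by `Σ ‖c_n‖`, and the integral by an integrable logarithm. -/
lemma hasSum_integral_cos_mul_log_two_mul_sin (m : ℂ) (φ : ℝ) :
    HasSum (fun n : ℕ => -(1 / ((n : ℂ) + 1))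
        * (Complex.cos (2 * (n + 1) * φ) * cosCoeff m (n + 1)))
      (∫ ψ in (-(Real.pi / 2))..(Real.pi / 2), Complex.cos (m * ψ)
        * ((Real.log |2 * Real.sin (φ + ψ)| : ℝ) : ℂ)) := by
  have hbd : ∀ n : ℕ, ‖Complex.cos (2 * (n + 1) * φ) * cosCoeff m (n + 1)‖
      ≤ ‖cosCoeff m (n + 1)‖ := by
    intro n
    rw [norm_mul]
    refine mul_le_of_le_one_left (norm_nonneg _) ?_
    rw [show (2 * (n + 1) * φ : ℂ) = ((2 * (n + 1) * φ : ℝ) : ℂ) by push_cast; ring,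
      ← Complex.ofReal_cos, Complex.norm_real]
    exact Real.abs_cos_le_one _
  have hcs : Summable fun n : ℕ => ‖cosCoeff m (n + 1)‖ :=
    (summable_nat_add_iff 1).2 (summable_norm_cosCoeff m)
  have hterm : ∀ (n : ℕ) (r : ℝ), |r| ≤ 1 → ‖-((r : ℂ) ^ (n + 1) / (n + 1))
        * (Complex.cos (2 * (n + 1) * φ) * cosCoeff m (n + 1))‖ ≤ ‖cosCoeff m (n + 1)‖ := by
    intro n r hr
    rw [norm_mul]
    refine (mul_le_of_le_one_left (norm_nonneg _) ?_).trans (hbd n)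
    rw [norm_neg, norm_div, norm_pow, Complex.norm_real, Real.norm_eq_abs,
      show ((n : ℂ) + 1) = ((n + 1 : ℕ) : ℂ) by push_cast; ring, Complex.norm_natCast]
    refine div_le_one_of_le₀ ((pow_le_one₀ (abs_nonneg _) hr).trans ?_) (by positivity)
    push_cast
    linarith [Nat.cast_nonneg (α := ℝ) n]
  have hmem : ∀ᶠ r : ℝ in 𝓝[<] 1, r ∈ Ioo (1 / 2 : ℝ) 1 := Ioo_mem_nhdsLT (by norm_num)
  have hseries : Tendsto (fun r : ℝ => ∑' n : ℕ, -((r : ℂ) ^ (n + 1) / (n + 1))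
        * (Complex.cos (2 * (n + 1) * φ) * cosCoeff m (n + 1))) (𝓝[<] 1)
      (𝓝 (∑' n : ℕ, -(1 / ((n : ℂ) + 1))
        * (Complex.cos (2 * (n + 1) * φ) * cosCoeff m (n + 1)))) := by
    refine tendsto_tsum_of_dominated_convergence hcs (fun n => ?_) ?_
    · have hc : Continuous fun r : ℝ => -((r : ℂ) ^ (n + 1) / (n + 1))
        * (Complex.cos (2 * (n + 1) * φ) * cosCoeff m (n + 1)) := by fun_prop
      have := (hc.tendsto 1).mono_left (nhdsWithin_le_nhds (s := Iio 1))
      simpa using this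
    · filter_upwards [hmem] with r hr n
      exact hterm n r (abs_le.2 ⟨by linarith [hr.1], hr.2.le⟩)
  have hintegral : Tendsto (fun r : ℝ => ∫ ψ in (-(Real.pi / 2))..(Real.pi / 2),
        Complex.cos (m * ψ)
          * ((1 / 2 * Real.log (1 - 2 * r * Real.cos (2 * (φ + ψ)) + r ^ 2) : ℝ) : ℂ)) (𝓝[<] 1)
      (𝓝 (∫ ψ in (-(Real.pi / 2))..(Real.pi / 2), Complex.cos (m * ψ)
        * ((Real.log |2 * Real.sin (φ + ψ)| : ℝ) : ℂ))) := by
    refine intervalIntegral.tendsto_integral_filter_of_dominated_convergence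
      (fun ψ => ‖Complex.cos (m * ψ)
        * ((Real.log 4 + |(Real.log |Real.sin (φ + ψ)|)| : ℝ) : ℂ)‖) ?_ ?_ ?_ ?_
    · refine Eventually.of_forall fun r => Measurable.aestronglyMeasurable ?_
      fun_prop
    · filter_upwards [hmem] with r hr
      filter_upwards [ae_sin_add_ne_zero φ] with ψ hψ _
      rw [norm_mul, norm_mul, Complex.norm_real, Complex.norm_real]
      gcongr
      have hsin : 0 < |Real.sin (φ + ψ)| := abs_pos.2 hψ
      have hs1 : |Real.sin (φ + ψ)| ≤ 1 := Real.abs_sin_le_one _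
      have hcos : Real.cos (2 * (φ + ψ)) = 1 - 2 * |Real.sin (φ + ψ)| ^ 2 := by
        rw [Real.cos_two_mul, sq_abs]
        linarith [Real.sin_sq_add_cos_sq (φ + ψ)]
      set s := |Real.sin (φ + ψ)|
      rw [hcos]
      -- The middle expression is `(1 - r)² + 4rs²`, at least `s²` because `r > 1/2`. After halving,
      -- the logarithms of the bounds `s²` and `4²` become `log s` and `log 4`, as in the dominating
      -- function.
      have hlo : s ^ 2 ≤ 1 - 2 * r * (1 - 2 * s ^ 2) + r ^ 2 := by
        nlinarith [sq_nonneg (1 - r), mul_nonneg (sub_nonneg.2 hr.1.le) (sq_nonneg s), hr.1]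
      have hhi : 1 - 2 * r * (1 - 2 * s ^ 2) + r ^ 2 ≤ 4 ^ 2 := by
        nlinarith [hr.1, hr.2, mul_le_mul hr.2.le (pow_le_one₀ hsin.le hs1 : s ^ 2 ≤ 1)
          (sq_nonneg s) zero_le_one]
      have hpos : 0 < 1 - 2 * r * (1 - 2 * s ^ 2) + r ^ 2 := (by positivity : 0 < s ^ 2).trans_le hlo
      have l1 := Real.log_le_log (by positivity) hlo
      have l2 := Real.log_le_log hpos hhi
      rw [Real.log_pow] at l1 l2
      push_cast at l1 l2
      have l4 : 0 ≤ Real.log 4 := Real.log_nonneg (by norm_num)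
      rw [Real.norm_eq_abs, Real.norm_eq_abs, abs_of_nonneg (a := Real.log 4 + _) (by positivity),
        abs_le]
      constructor <;> linarith [neg_abs_le (Real.log s), abs_nonneg (Real.log s)]
    · refine (intervalIntegrable_cos_mul m (f := fun ψ => Real.log 4 + |(Real.log |Real.sin (φ + ψ)|)|)
        ?_).norm
      exact intervalIntegrable_const.add
        (intervalIntegrable_log_abs (fun x => by fun_prop) _ _).abs
    · filter_upwards [ae_sin_add_ne_zero φ] with ψ hψ _
      have hlim : 1 / 2 * Real.log (1 - 2 * 1 * Real.cos (2 * (φ + ψ)) + 1 ^ 2)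
          = Real.log |2 * Real.sin (φ + ψ)| := by
        rw [show 1 - 2 * 1 * Real.cos (2 * (φ + ψ)) + 1 ^ 2 = (2 * Real.sin (φ + ψ)) ^ 2 by
          rw [Real.cos_two_mul]
          nlinarith [Real.sin_sq_add_cos_sq (φ + ψ)], Real.log_pow, Real.log_abs]
        push_cast
        ring
      have hne : 1 - 2 * 1 * Real.cos (2 * (φ + ψ)) + 1 ^ 2 ≠ 0 := by
        rw [Real.cos_two_mul, Real.cos_sq']
        have := sq_pos_of_ne_zero hψ
        nlinarith
      rw [← hlim]
      refine Tendsto.mono_left ?_ (nhdsWithin_le_nhds (s := Iio 1))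
      refine Tendsto.mul tendsto_const_nhds ?_
      refine (Complex.continuous_ofReal.tendsto _).comp ?_
      refine Tendsto.mul tendsto_const_nhds ?_
      refine Tendsto.log ?_ hne
      exact Continuous.tendsto (f := fun r : ℝ => 1 - 2 * r * Real.cos (2 * (φ + ψ)) + r ^ 2)
        (by fun_prop) 1
  have hev : (fun r : ℝ => ∑' n : ℕ, -((r : ℂ) ^ (n + 1) / (n + 1))
        * (Complex.cos (2 * (n + 1) * φ) * cosCoeff m (n + 1))) =ᶠ[𝓝[<] 1] fun r : ℝ =>
        ∫ ψ in (-(Real.pi / 2))..(Real.pi / 2), Complex.cos (m * ψ)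
          * ((1 / 2 * Real.log (1 - 2 * r * Real.cos (2 * (φ + ψ)) + r ^ 2) : ℝ) : ℂ) := by
    filter_upwards [hmem] with r hr
    exact (hasSum_integral_cos_mul_log (abs_lt.2 ⟨by linarith [hr.1], hr.2⟩) m φ).tsum_eq
  rw [← tendsto_nhds_unique (hseries.congr' hev) hintegral]
  refine Summable.hasSum (Summable.of_norm_bounded hcs fun n => ?_)
  simpa using hterm n 1 (by simp)

/-! ### Reduction of the angular kernels by parity -/

lemma integral_cos_mul_comp_neg (m : ℂ) (g : ℝ → ℝ) (c : ℝ) :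
    ∫ ψ in (-c)..c, Complex.cos (m * ψ) * (g (-ψ) : ℂ)
      = ∫ ψ in (-c)..c, Complex.cos (m * ψ) * (g ψ : ℂ) := by
  have h := intervalIntegral.integral_comp_neg (a := -c) (b := c)
    (fun ψ : ℝ => Complex.cos (m * ψ) * (g ψ : ℂ))
  rw [neg_neg] at h
  rw [← h]
  refine intervalIntegral.integral_congr fun ψ _ => ?_
  simp only [Complex.ofReal_neg, mul_neg, Complex.cos_neg]

/-- Only the even part of `g` contributes to `∫ cos (m ψ) g(ψ)`. -/
lemma integral_cos_mul_congr_even (m : ℂ) {g h : ℝ → ℝ} {c : ℝ}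
    (hg : IntervalIntegrable g volume (-c) c) (hh : IntervalIntegrable h volume (-c) c)
    (heq : ∀ᵐ ψ : ℝ, g ψ + g (-ψ) = h ψ + h (-ψ)) :
    ∫ ψ in (-c)..c, Complex.cos (m * ψ) * (g ψ : ℂ)
      = ∫ ψ in (-c)..c, Complex.cos (m * ψ) * (h ψ : ℂ) := by
  have hneg : ∀ {f : ℝ → ℝ}, IntervalIntegrable f volume (-c) c →
      IntervalIntegrable (fun ψ => f (-ψ)) volume (-c) c := by
    intro f hf
    have h1 := (IntervalIntegrable.comp_mul_left (c := -1) hf).symm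
    simpa [div_neg] using h1
  have hdouble : ∀ {f : ℝ → ℝ}, IntervalIntegrable f volume (-c) c →
      2 * ∫ ψ in (-c)..c, Complex.cos (m * ψ) * (f ψ : ℂ)
        = ∫ ψ in (-c)..c, Complex.cos (m * ψ) * ((f ψ + f (-ψ) : ℝ) : ℂ) := by
    intro f hf
    rw [two_mul]
    nth_rewrite 2 [← integral_cos_mul_comp_neg]
    rw [← intervalIntegral.integral_add (intervalIntegrable_cos_mul m hf)
      (intervalIntegrable_cos_mul m (hneg hf))]
    refine intervalIntegral.integral_congr fun ψ _ => ?_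
    push_cast
    ring
  apply mul_left_cancel₀ (two_ne_zero (α := ℂ))
  rw [hdouble hg, hdouble hh]
  refine intervalIntegral.integral_congr_ae ?_
  filter_upwards [heq] with ψ hψ _
  rw [hψ]

lemma intervalIntegrable_log_sin_add_sin (φ a b : ℝ) :
    IntervalIntegrable (fun ψ => Real.log |Real.sin φ + Real.sin ψ|) volume a b :=
  intervalIntegrable_log_abs (fun x => by fun_prop) a b

lemma cosCoeff_zero_eq (m : ℂ) :
    cosCoeff m 0 = ∫ ψ in (-(Real.pi / 2))..(Real.pi / 2), Complex.cos (m * ψ) := by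
  simp [cosCoeff]

/-- Since `(sin φ + sin ψ)(sin φ - sin ψ) = sin(φ + ψ) sin(φ - ψ)`, the two logarithms have the same
even part in `ψ` up to the constant `log 2`. -/
lemma integral_cos_mul_log_sin_add_sin (m : ℂ) (φ : ℝ) :
    ∫ ψ in (-(Real.pi / 2))..(Real.pi / 2),
        Complex.cos (m * ψ) * ((Real.log |Real.sin φ + Real.sin ψ| : ℝ) : ℂ)
      = (∫ ψ in (-(Real.pi / 2))..(Real.pi / 2), Complex.cos (m * ψ)
          * ((Real.log |2 * Real.sin (φ + ψ)| : ℝ) : ℂ)) - Real.log 2 * cosCoeff m 0 := by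
  have hint : IntervalIntegrable (fun ψ => Real.log |2 * Real.sin (φ + ψ)|) volume
      (-(Real.pi / 2)) (Real.pi / 2) := intervalIntegrable_log_abs (fun x => by fun_prop) _ _
  rw [integral_cos_mul_congr_even m (intervalIntegrable_log_sin_add_sin φ _ _)
    (hint.sub (intervalIntegrable_const (c := Real.log 2))), cosCoeff_zero_eq,
    ← intervalIntegral.integral_const_mul, ← intervalIntegral.integral_sub
      (intervalIntegrable_cos_mul m hint) (Continuous.intervalIntegrable (by fun_prop) _ _)]
  · refine intervalIntegral.integral_congr fun ψ _ => ?_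
    push_cast
    ring
  · have hminus : ∀ᵐ ψ : ℝ, Real.sin (φ - ψ) ≠ 0 := by
      filter_upwards [ae_sin_add_ne_zero (-φ)] with ψ hψ
      rw [← neg_ne_zero, ← Real.sin_neg]
      convert! hψ using 2
      ring
    filter_upwards [ae_sin_add_ne_zero φ, hminus] with ψ h1 h2
    have hprod : (Real.sin φ + Real.sin ψ) * (Real.sin φ - Real.sin ψ)
        = Real.sin (φ + ψ) * Real.sin (φ - ψ) := by
      rw [Real.sin_add, Real.sin_sub]
      linear_combination -Real.sin φ ^ 2 * Real.sin_sq_add_cos_sq ψ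
        + Real.sin ψ ^ 2 * Real.sin_sq_add_cos_sq φ
    have hne : (Real.sin φ + Real.sin ψ) * (Real.sin φ - Real.sin ψ) ≠ 0 := by
      rw [hprod]
      exact mul_ne_zero h1 h2
    simp only [Real.log_abs, Real.sin_neg, ← sub_eq_add_neg]
    rw [← Real.log_mul (left_ne_zero_of_mul hne) (right_ne_zero_of_mul hne), hprod,
      Real.log_mul h1 h2, Real.log_mul two_ne_zero h1, Real.log_mul two_ne_zero h2]
    ring

/-- Factorization as `e^{2s}/4 · |1 + e^{-2s + 2iφ}|²`: the prefactor carries the growth subtracted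
by `G`, and the rest has the logarithmic series with `r = -e^{-2s}`. -/
lemma cosh_sq_sub_sin_sq (s φ : ℝ) :
    Real.cosh s ^ 2 - Real.sin φ ^ 2 = Real.exp (2 * s) / 4
      * (1 - 2 * (-Real.exp (-2 * s)) * Real.cos (2 * φ) + (-Real.exp (-2 * s)) ^ 2) := by
  have h1 : Real.exp (2 * s) * Real.exp (-2 * s) = 1 := by rw [← Real.exp_add]; simp
  have h2 : Real.exp (2 * s) = Real.exp s ^ 2 := by rw [← Real.exp_nat_mul]; norm_num
  have h3 : Real.exp (-2 * s) = Real.exp (-s) ^ 2 := by rw [← Real.exp_nat_mul]; norm_num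
  have h4 : Real.exp s * Real.exp (-s) = 1 := by rw [← Real.exp_add]; simp
  have h5 : Real.sin φ ^ 2 = 1 - Real.cos φ ^ 2 := Real.sin_sq φ
  rw [Real.cosh_eq, Real.cos_two_mul, h5]
  linear_combination (-(2 * (2 * Real.cos φ ^ 2 - 1) + Real.exp (-2 * s)) / 4) * h1 + h2 / 4 * (-1)
    + h3 / 4 * (-1) + h4 / 2

lemma log_cosh_sq_sub_sin_sq {s : ℝ} (hs : 0 < s) (φ : ℝ) :
    Real.log |Real.cosh s ^ 2 - Real.sin φ ^ 2| = 2 * s - Real.log 4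
      + Real.log (1 - 2 * (-Real.exp (-2 * s)) * Real.cos (2 * φ) + (-Real.exp (-2 * s)) ^ 2) := by
  have hr : |(-Real.exp (-2 * s))| < 1 := by
    rw [abs_neg, abs_of_pos (Real.exp_pos _), Real.exp_lt_one_iff]
    linarith
  rw [cosh_sq_sub_sin_sq, Real.log_abs, Real.log_mul (by positivity)
    (one_sub_two_mul_cos_add_sq_pos hr _).ne', Real.log_div (Real.exp_pos _).ne' (by norm_num),
    Real.log_exp]

lemma cosh_add_sin_pos {σ : ℝ} (hσ : 0 < σ) (ψ : ℝ) : 0 < Real.cosh σ + Real.sin ψ := by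
  linarith [Real.one_lt_cosh.2 hσ.ne', Real.neg_one_le_sin ψ]

lemma intervalIntegrable_log_cosh_add_sin (σ a b : ℝ) :
    IntervalIntegrable (fun ψ => Real.log |Real.cosh σ + Real.sin ψ|) volume a b :=
  intervalIntegrable_log_abs (fun x => by fun_prop) a b

/-- Multiplying the values at `ψ` and `-ψ` gives `cosh² σ - sin² ψ`, so the preceding factorization
determines the even part. -/
lemma integral_cos_mul_log_cosh_add_sin (m : ℂ) {σ : ℝ} (hσ : 0 < σ) :
    ∫ ψ in (-(Real.pi / 2))..(Real.pi / 2),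
        Complex.cos (m * ψ) * ((Real.log |Real.cosh σ + Real.sin ψ| : ℝ) : ℂ)
      = (∫ ψ in (-(Real.pi / 2))..(Real.pi / 2), Complex.cos (m * ψ)
          * ((1 / 2 * Real.log (1 - 2 * (-Real.exp (-2 * σ)) * Real.cos (2 * (0 + ψ))
            + (-Real.exp (-2 * σ)) ^ 2) : ℝ) : ℂ)) + (σ - Real.log 2) * cosCoeff m 0 := by
  have hr : |(-Real.exp (-2 * σ))| < 1 := by
    rw [abs_neg, abs_of_pos (Real.exp_pos _), Real.exp_lt_one_iff]
    linarith
  have hint : IntervalIntegrable (fun ψ => 1 / 2 * Real.log (1 - 2 * (-Real.exp (-2 * σ))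
      * Real.cos (2 * (0 + ψ)) + (-Real.exp (-2 * σ)) ^ 2)) volume
      (-(Real.pi / 2)) (Real.pi / 2) := by
    refine Continuous.intervalIntegrable ?_ _ _
    refine continuous_const.mul (Continuous.log (by fun_prop) fun ψ => ?_)
    exact (one_sub_two_mul_cos_add_sq_pos hr _).ne'
  rw [integral_cos_mul_congr_even m (intervalIntegrable_log_cosh_add_sin σ _ _)
    (hint.add (intervalIntegrable_const (c := σ - Real.log 2))), cosCoeff_zero_eq,
    ← intervalIntegral.integral_const_mul, ← intervalIntegral.integral_add
      (intervalIntegrable_cos_mul m hint) (Continuous.intervalIntegrable (by fun_prop) _ _)]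
  · refine intervalIntegral.integral_congr fun ψ _ => ?_
    push_cast
    ring
  · refine ae_of_all _ fun ψ => ?_
    have h1 := log_cosh_sq_sub_sin_sq hσ ψ
    have hp := cosh_add_sin_pos hσ ψ
    have hm := cosh_add_sin_pos hσ (-ψ)
    rw [show Real.cosh σ ^ 2 - Real.sin ψ ^ 2
      = (Real.cosh σ + Real.sin ψ) * (Real.cosh σ + Real.sin (-ψ)) by rw [Real.sin_neg]; ring,
      Real.log_abs, Real.log_mul hp.ne' hm.ne'] at h1
    simp only [Real.log_abs, zero_add]
    rw [h1, mul_neg 2 ψ, Real.cos_neg, show (4 : ℝ) = 2 ^ 2 by norm_num, Real.log_pow]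
    push_cast
    ring

/-! ### Radial integrals -/

/-- Termwise integration of a series of decaying exponentials over a half-line. -/
lemma hasSum_integral_exp_series {m : ℂ} (hm : m.re < 1) {c K : ℝ} {A : ℕ → ℂ} {g : ℝ → ℂ}
    (hA : ∀ n : ℕ, ‖A n‖ ≤ K * Real.exp (2 * (n + 1) * c))
    (hg : ∀ s ∈ Ioi c, HasSum (fun n : ℕ => A n / (n + 1) * Complex.exp ((m - 2 * (n + 1)) * s))
      (g s)) :
    IntegrableOn g (Ioi c) ∧
      HasSum (fun n : ℕ => A n / (n + 1) * (Complex.exp ((m - 2 * (n + 1)) * c)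
        / (2 * (n + 1) - m))) (∫ s in Ioi c, g s) := by
  have hre : ∀ n : ℕ, (m - 2 * (n + 1)).re = m.re - 2 * (n + 1) := by intro n; simp
  have hneg : ∀ n : ℕ, (m - 2 * (n + 1)).re < 0 := by
    intro n
    rw [hre]
    linarith [Nat.cast_nonneg (α := ℝ) n]
  have hsum : Summable fun n : ℕ => ∫ s in Ioi c,
      ‖A n / (n + 1) * Complex.exp ((m - 2 * (n + 1)) * s)‖ := by
    refine Summable.of_nonneg_of_le (fun n => integral_nonneg fun s => norm_nonneg _) (fun n => ?_)
      (((summable_nat_add_iff 1).2 (Real.summable_one_div_nat_pow.2 one_lt_two)).mul_left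
        (K * Real.exp (m.re * c)))
    have hn : (0 : ℝ) < n + 1 := by positivity
    have hexp : ∀ s : ℝ, ‖A n / (n + 1) * Complex.exp ((m - 2 * (n + 1)) * s)‖
        = ‖A n‖ / (n + 1) * Real.exp ((m.re - 2 * (n + 1)) * s) := by
      intro s
      rw [norm_mul, norm_div, Complex.norm_exp, Complex.re_mul_ofReal, hre,
        show ((n : ℂ) + 1) = ((n + 1 : ℕ) : ℂ) by push_cast; ring, Complex.norm_natCast]
      push_cast
      rfl
    simp_rw [hexp]
    have hlt := hneg n
    rw [hre] at hlt
    rw [integral_const_mul, integral_exp_mul_Ioi hlt, neg_div, ← div_neg, neg_sub]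
    calc ‖A n‖ / (n + 1) * (Real.exp ((m.re - 2 * (n + 1)) * c) / (2 * (n + 1) - m.re))
        ≤ K * Real.exp (2 * (n + 1) * c) / (n + 1)
          * (Real.exp ((m.re - 2 * (n + 1)) * c) / (n + 1)) := by
          -- Here `Re m < 1` gives `2(n + 1) - Re m ≥ n + 1`, the second factor needed for a `1/(n +
          -- 1)²` bound.
          refine mul_le_mul (div_le_div_of_nonneg_right (hA n) hn.le)
            (div_le_div_of_nonneg_left (Real.exp_nonneg _) hn ?_)
            (div_nonneg (Real.exp_nonneg _) (by linarith))
            (div_nonneg ((norm_nonneg _).trans (hA n)) hn.le)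
          linarith [Nat.cast_nonneg (α := ℝ) n]
      _ = K * (Real.exp (2 * (n + 1) * c) * Real.exp ((m.re - 2 * (n + 1)) * c))
          * (1 / (n + 1) ^ 2) := by field_simp
      _ = K * Real.exp (m.re * c) * (1 / ((n + 1 : ℕ) : ℝ) ^ 2) := by
          rw [← Real.exp_add]
          push_cast
          ring_nf
  obtain ⟨h1, h2⟩ := integrable_and_hasSum_integral (μ := volume.restrict (Ioi c))
    (F := fun (n : ℕ) (s : ℝ) => A n / (n + 1) * Complex.exp ((m - 2 * (n + 1)) * s)) (g := g)
    (fun n => (integrableOn_exp_mul_complex_Ioi (hneg n) c).const_mul _) hsum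
    ((ae_restrict_iff' measurableSet_Ioi).2 (ae_of_all _ hg))
  refine ⟨h1, ?_⟩
  convert! h2 using 1
  funext n
  rw [integral_const_mul, integral_exp_mul_complex_Ioi (hneg n) c, neg_div, ← div_neg, neg_sub]

lemma norm_cos_ofReal_le_one (x : ℝ) : ‖Complex.cos (x : ℂ)‖ ≤ 1 := by
  rw [← Complex.ofReal_cos, Complex.norm_real]
  exact Real.abs_cos_le_one x

lemma radial_angle {m : ℂ} (hm : m.re < 1) (φ : ℝ) :
    IntegrableOn (fun s : ℝ => Complex.exp (m * s)
      * ((Real.log |Real.cosh s ^ 2 - Real.sin φ ^ 2| - (2 * s - Real.log 4) : ℝ) : ℂ)) (Ioi 0) ∧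
    HasSum (fun n : ℕ => -2 * (-1) ^ (n + 1) * Complex.cos (2 * (n + 1) * φ) / (n + 1)
        * (1 / (2 * (n + 1) - m)))
      (∫ s in Ioi (0 : ℝ), Complex.exp (m * s)
        * ((Real.log |Real.cosh s ^ 2 - Real.sin φ ^ 2| - (2 * s - Real.log 4) : ℝ) : ℂ)) := by
  have h := hasSum_integral_exp_series hm (c := 0) (K := 2)
    (A := fun n : ℕ => -2 * (-1) ^ (n + 1) * Complex.cos (2 * (n + 1) * φ))
    (g := fun s : ℝ => Complex.exp (m * s)
      * ((Real.log |Real.cosh s ^ 2 - Real.sin φ ^ 2| - (2 * s - Real.log 4) : ℝ) : ℂ)) ?_ ?_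
  · simpa using h
  · intro n
    have h1 := norm_cos_ofReal_le_one (2 * (n + 1) * φ)
    push_cast at h1
    simpa using h1
  · intro s hs
    have hs : 0 < s := hs
    have hr : |(-Real.exp (-2 * s))| < 1 := by
      rw [abs_neg, abs_of_pos (Real.exp_pos _), Real.exp_lt_one_iff]
      linarith
    have h1 := (Complex.hasSum_ofReal.2
      (hasSum_log_one_sub_two_mul_cos hr (2 * φ))).mul_left (2 * Complex.exp (m * s))
    rw [log_cosh_sq_sub_sin_sq hs]
    convert! h1 using 1
    · funext n
      rw [show (m - 2 * (n + 1)) * s = m * s + ((n + 1 : ℕ) : ℂ) * (-2 * s) by push_cast; ring,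
        Complex.exp_add, Complex.exp_nat_mul, neg_pow (Real.exp (-2 * s))]
      push_cast
      ring_nf
    · push_cast
      ring

lemma hasSum_log_one_sub_exp {t : ℝ} (ht : 0 < t) :
    HasSum (fun n : ℕ => -(Complex.exp (-2 * (n + 1) * t) / (n + 1)))
      ((Real.log (1 - Real.exp (-2 * t)) : ℝ) : ℂ) := by
  have hr : |Real.exp (-2 * t)| < 1 := by
    rw [abs_of_pos (Real.exp_pos _), Real.exp_lt_one_iff]
    linarith
  have h := (Complex.hasSum_ofReal.2 (Real.hasSum_pow_div_log_of_abs_lt_one hr)).neg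
  convert! h using 1
  · funext n
    rw [← Real.exp_nat_mul]
    push_cast
    ring_nf
  · push_cast
    ring

/-- The difference factors as `sinh(s + σ) sinh(s - σ)`, and `2 sinh x = e^x (1 - e^{-2x})`. The
term `|s - σ| + (σ - s)` vanishes beyond `σ` and equals `2(σ - s)` before it. -/
lemma log_cosh_sq_sub_cosh_sq {s σ : ℝ} (hs : 0 < s) (hσ : 0 < σ) (hne : s ≠ σ) :
    Real.log |Real.cosh s ^ 2 - Real.cosh σ ^ 2| - (2 * s - Real.log 4)
      = (|s - σ| + (σ - s)) + Real.log (1 - Real.exp (-2 * (s + σ)))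
        + Real.log (1 - Real.exp (-2 * |s - σ|)) := by
  have hsinh : ∀ x : ℝ, 2 * Real.sinh x = Real.exp x * (1 - Real.exp (-2 * x)) := by
    intro x
    rw [Real.sinh_eq, mul_sub, ← Real.exp_add]
    ring_nf
  have hpos : ∀ {x : ℝ}, 0 < x → 0 < 1 - Real.exp (-2 * x) := by
    intro x hx
    rw [sub_pos, Real.exp_lt_one_iff]
    linarith
  have habs : 0 < |s - σ| := abs_pos.2 (sub_ne_zero.2 hne)
  have hfac : Real.cosh s ^ 2 - Real.cosh σ ^ 2 = Real.sinh (s + σ) * Real.sinh (s - σ) := by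
    rw [Real.sinh_add, Real.sinh_sub]
    linear_combination Real.cosh σ ^ 2 * Real.cosh_sq_sub_sinh_sq s
      - Real.cosh s ^ 2 * Real.cosh_sq_sub_sinh_sq σ
  have hval : |Real.cosh s ^ 2 - Real.cosh σ ^ 2| = Real.exp (s + σ + |s - σ|)
      * ((1 - Real.exp (-2 * (s + σ))) * (1 - Real.exp (-2 * |s - σ|))) / 4 := by
    rw [hfac, abs_mul, Real.abs_sinh, Real.abs_sinh, abs_of_pos (add_pos hs hσ), Real.exp_add]
    linear_combination Real.sinh |s - σ| / 2 * hsinh (s + σ)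
      + Real.exp (s + σ) * (1 - Real.exp (-2 * (s + σ))) / 4 * hsinh |s - σ|
  have h1 := hpos (add_pos hs hσ)
  have h2 := hpos habs
  rw [hval, Real.log_div (by positivity) (by norm_num), Real.log_mul (by positivity) (by positivity),
    Real.log_exp, Real.log_mul h1.ne' h2.ne']
  ring

/-- `∫_0^σ exp (m s) exp (-2 n (σ - s)) ds`. -/
noncomputable def innerCoeff (m : ℂ) (σ : ℝ) (n : ℕ) : ℂ :=
  ∫ s in (0 : ℝ)..σ, Complex.exp (m * s) * Complex.exp (-2 * n * (σ - s))

/-- Kept in multiplied form because `m = -2n` is allowed. -/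
lemma innerCoeff_identity (m : ℂ) (σ : ℝ) (n : ℕ) :
    (m + 2 * n) * innerCoeff m σ n = Complex.exp (m * σ) - Complex.exp (-2 * n * σ) := by
  have hderiv : ∀ x ∈ uIcc 0 σ, HasDerivAt
      (fun s : ℝ => Complex.exp (m * s) * Complex.exp (-2 * n * (σ - s)))
      ((m + 2 * n) * (Complex.exp (m * x) * Complex.exp (-2 * n * (σ - x)))) x := by
    intro x _
    have hid := hasDerivAt_id' (x : ℂ)
    refine ((hid.const_mul m).cexp.mul
      ((hid.const_sub (σ : ℂ)).const_mul (-2 * (n : ℂ))).cexp).comp_ofReal.congr_deriv ?_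
    ring
  have h := intervalIntegral.integral_eq_sub_of_hasDerivAt hderiv
    (Continuous.intervalIntegrable (by fun_prop) _ _)
  rw [intervalIntegral.integral_const_mul] at h
  rw [innerCoeff, h]
  simp

lemma integral_exp_mul_linear (m : ℂ) (σ : ℝ) :
    m ^ 2 * ∫ s in (0 : ℝ)..σ, Complex.exp (m * s) * (2 * (σ - s))
      = 2 * (Complex.exp (m * σ) - 1 - m * σ) := by
  have hderiv : ∀ x ∈ uIcc 0 σ, HasDerivAt
      (fun s : ℝ => Complex.exp (m * s) * (2 * m * (σ - s) + 2))
      (m ^ 2 * (Complex.exp (m * x) * (2 * (σ - x)))) x := by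
    intro x _
    have hid := hasDerivAt_id' (x : ℂ)
    refine ((hid.const_mul m).cexp.mul
      (((hid.const_sub (σ : ℂ)).const_mul (2 * m)).add_const 2)).comp_ofReal.congr_deriv ?_
    ring
  have h := intervalIntegral.integral_eq_sub_of_hasDerivAt hderiv
    (Continuous.intervalIntegrable (by fun_prop) _ _)
  rw [intervalIntegral.integral_const_mul] at h
  rw [h]
  simp
  ring

lemma radial_outer_sum {m : ℂ} (hm : m.re < 1) {σ : ℝ} (hσ : 0 < σ) :
    IntegrableOn (fun s : ℝ => Complex.exp (m * s)
      * ((Real.log (1 - Real.exp (-2 * (s + σ))) : ℝ) : ℂ)) (Ioi 0) ∧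
    HasSum (fun n : ℕ => -Complex.exp (-2 * (n + 1) * σ) / (n + 1) * (1 / (2 * (n + 1) - m)))
      (∫ s in Ioi (0 : ℝ), Complex.exp (m * s)
        * ((Real.log (1 - Real.exp (-2 * (s + σ))) : ℝ) : ℂ)) := by
  have h := hasSum_integral_exp_series hm (c := 0) (K := 1)
    (A := fun n : ℕ => -Complex.exp (-2 * (n + 1) * σ))
    (g := fun s : ℝ => Complex.exp (m * s)
      * ((Real.log (1 - Real.exp (-2 * (s + σ))) : ℝ) : ℂ)) ?_ ?_
  · simpa using h
  · intro n
    rw [norm_neg, Complex.norm_exp]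
    simp
    positivity
  · intro s hs
    have h1 := (hasSum_log_one_sub_exp (add_pos hs hσ)).mul_left (Complex.exp (m * s))
    convert! h1 using 1
    funext n
    rw [show (m - 2 * (n + 1)) * s = m * s + -2 * (n + 1) * s by ring, Complex.exp_add,
      Complex.ofReal_add, mul_add (-2 * ((n : ℂ) + 1)), Complex.exp_add]
    ring

/-- The coefficients `e^{2(n+1)σ}` grow, but exactly at the rate compensated by starting the
half-line at `σ`. -/
lemma radial_outer_diff {m : ℂ} (hm : m.re < 1) (σ : ℝ) :
    IntegrableOn (fun s : ℝ => Complex.exp (m * s)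
      * ((Real.log (1 - Real.exp (-2 * |s - σ|)) : ℝ) : ℂ)) (Ioi σ) ∧
    HasSum (fun n : ℕ => -Complex.exp (m * σ) / (n + 1) * (1 / (2 * (n + 1) - m)))
      (∫ s in Ioi σ, Complex.exp (m * s)
        * ((Real.log (1 - Real.exp (-2 * |s - σ|)) : ℝ) : ℂ)) := by
  have h := hasSum_integral_exp_series hm (c := σ) (K := 1)
    (A := fun n : ℕ => -Complex.exp (2 * (n + 1) * σ))
    (g := fun s : ℝ => Complex.exp (m * s)
      * ((Real.log (1 - Real.exp (-2 * |s - σ|)) : ℝ) : ℂ)) ?_ ?_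
  · refine ⟨h.1, ?_⟩
    convert! h.2 using 1
    funext n
    rw [show m * σ = 2 * (n + 1) * σ + (m - 2 * (n + 1)) * σ by ring, Complex.exp_add]
    ring
  · intro n
    rw [norm_neg, Complex.norm_exp]
    simp
  · intro s hs
    have hs' : 0 < s - σ := sub_pos.2 hs
    have h1 := (hasSum_log_one_sub_exp hs').mul_left (Complex.exp (m * s))
    rw [abs_of_pos hs']
    convert! h1 using 1
    funext n
    rw [show (m - 2 * (n + 1)) * s = m * s + -2 * (n + 1) * s by ring, Complex.exp_add,
      Complex.ofReal_sub, show -2 * ((n : ℂ) + 1) * (s - σ) = -2 * (n + 1) * s + 2 * (n + 1) * σ by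
        ring, Complex.exp_add]
    ring

/-- Before `σ` the series is in powers of `e^{-2(σ - s)}`. Integrating each exponential gains a
factor `1/(n + 1)`, which makes the `L¹` norms summable despite the singularity at `s = σ`. -/
lemma radial_inner_diff (m : ℂ) {σ : ℝ} (hσ : 0 < σ) :
    IntegrableOn (fun s : ℝ => Complex.exp (m * s)
      * ((Real.log (1 - Real.exp (-2 * |s - σ|)) : ℝ) : ℂ)) (Ioc 0 σ) ∧
    HasSum (fun n : ℕ => -(innerCoeff m σ (n + 1) / (n + 1)))
      (∫ s in Ioc 0 σ, Complex.exp (m * s)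
        * ((Real.log (1 - Real.exp (-2 * |s - σ|)) : ℝ) : ℂ)) := by
  have hcont : ∀ n : ℕ, Continuous fun s : ℝ => Complex.exp (m * s)
      * -(Complex.exp (-2 * (n + 1) * (σ - s)) / (n + 1)) := fun n => by fun_prop
  have hint : ∀ n : ℕ, IntegrableOn (fun s : ℝ => Complex.exp (m * s)
      * -(Complex.exp (-2 * (n + 1) * (σ - s)) / (n + 1))) (Ioc 0 σ) := fun n =>
    ((hcont n).integrableOn_Icc).mono_set Ioc_subset_Icc_self
  have hsum : Summable fun n : ℕ => ∫ s in Ioc 0 σ, ‖Complex.exp (m * s)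
      * -(Complex.exp (-2 * (n + 1) * (σ - s)) / (n + 1))‖ := by
    refine Summable.of_nonneg_of_le (fun n => integral_nonneg fun s => norm_nonneg _) (fun n => ?_)
      (((summable_nat_add_iff 1).2 (Real.summable_one_div_nat_pow.2 one_lt_two)).mul_left
        (Real.exp (|m.re| * σ)))
    have hn : (0 : ℝ) < n + 1 := by positivity
    have hdom : ∀ s ∈ Ioc 0 σ, ‖Complex.exp (m * s)
        * -(Complex.exp (-2 * (n + 1) * (σ - s)) / (n + 1))‖
        ≤ Real.exp (|m.re| * σ) / (n + 1) * Real.exp (-2 * (n + 1) * (σ - s)) := by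
      intro s hs
      rw [norm_mul, norm_neg, norm_div, Complex.norm_exp, Complex.re_mul_ofReal,
        show (-2 * (n + 1) * (σ - s) : ℂ) = ((-2 * (n + 1) * (σ - s) : ℝ) : ℂ) by push_cast; ring,
        ← Complex.ofReal_exp, Complex.norm_real, Real.norm_eq_abs, Real.abs_exp,
        show ((n : ℂ) + 1) = ((n + 1 : ℕ) : ℂ) by push_cast; ring, Complex.norm_natCast]
      push_cast
      rw [mul_div_assoc', div_mul_eq_mul_div]
      refine div_le_div_of_nonneg_right (mul_le_mul_of_nonneg_right (Real.exp_le_exp.2 ?_)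
        (Real.exp_nonneg _)) hn.le
      exact mul_le_mul (le_abs_self _) hs.2 hs.1.le (abs_nonneg _)
    have hderiv : ∀ x ∈ uIcc 0 σ, HasDerivAt
        (fun s : ℝ => Real.exp (-2 * (n + 1) * (σ - s)) / (2 * (n + 1)))
        (Real.exp (-2 * (n + 1) * (σ - x))) x := by
      intro x _
      refine ((((hasDerivAt_id' x).const_sub σ).const_mul (-2 * ((n : ℝ) + 1))).exp.div_const
        _).congr_deriv ?_
      field_simp
    have hval := intervalIntegral.integral_eq_sub_of_hasDerivAt hderiv
      (Continuous.intervalIntegrable (by fun_prop) _ _)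
    have hcr : Continuous fun s : ℝ =>
      Real.exp (|m.re| * σ) / (n + 1) * Real.exp (-2 * (n + 1) * (σ - s)) := by fun_prop
    refine (setIntegral_mono_on (hint n).norm
      (hcr.integrableOn_Icc.mono_set Ioc_subset_Icc_self) measurableSet_Ioc hdom).trans ?_
    rw [integral_const_mul, ← intervalIntegral.integral_of_le hσ.le, hval, sub_self, mul_zero,
      Real.exp_zero]
    have hb : 1 / (2 * ((n : ℝ) + 1)) - Real.exp (-2 * (n + 1) * (σ - 0)) / (2 * (n + 1))
        ≤ 1 / (n + 1) := by
      have : 0 ≤ Real.exp (-2 * (n + 1) * (σ - 0)) / (2 * ((n : ℝ) + 1)) := by positivity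
      have h2 : 1 / (2 * ((n : ℝ) + 1)) ≤ 1 / (n + 1) :=
        one_div_le_one_div_of_le hn (by linarith)
      linarith
    calc _ ≤ Real.exp (|m.re| * σ) / (n + 1) * (1 / (n + 1)) := by gcongr
      _ = _ := by push_cast; field_simp
  obtain ⟨h1, h2⟩ := integrable_and_hasSum_integral (μ := volume.restrict (Ioc 0 σ)) hint hsum
    (g := fun s : ℝ => Complex.exp (m * s)
      * ((Real.log (1 - Real.exp (-2 * |s - σ|)) : ℝ) : ℂ)) (by
    rw [ae_restrict_iff' measurableSet_Ioc]
    filter_upwards [Measure.ae_ne volume σ] with s hne hs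
    have hs' : 0 < σ - s := sub_pos.2 (lt_of_le_of_ne hs.2 hne)
    rw [abs_sub_comm, abs_of_pos hs']
    have h3 := (hasSum_log_one_sub_exp hs').mul_left (Complex.exp (m * s))
    push_cast at h3 ⊢
    exact h3)
  refine ⟨h1, ?_⟩
  convert! h2 using 1
  funext n
  rw [innerCoeff, ← intervalIntegral.integral_of_le hσ.le, ← intervalIntegral.integral_div,
    ← intervalIntegral.integral_neg]
  refine intervalIntegral.integral_congr fun s _ => ?_
  push_cast
  ring

/-- The three series come from `log(1 - e^{-2(s+σ)})` and from the two sides of `σ`. The piecewise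
linear term has a closed-form integral and is kept out of the series. -/
lemma radial_point {m : ℂ} (hm : m.re < 1) {σ : ℝ} (hσ : 0 < σ) :
    IntegrableOn (fun s : ℝ => Complex.exp (m * s)
      * ((Real.log |Real.cosh s ^ 2 - Real.cosh σ ^ 2| - (2 * s - Real.log 4) : ℝ) : ℂ)) (Ioi 0) ∧
    HasSum (fun n : ℕ => -Complex.exp (-2 * (n + 1) * σ) / (n + 1) * (1 / (2 * (n + 1) - m))
        - Complex.exp (m * σ) / (n + 1) * (1 / (2 * (n + 1) - m))
        - innerCoeff m σ (n + 1) / (n + 1))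
      ((∫ s in Ioi (0 : ℝ), Complex.exp (m * s)
        * ((Real.log |Real.cosh s ^ 2 - Real.cosh σ ^ 2| - (2 * s - Real.log 4) : ℝ) : ℂ))
        - ∫ s in (0 : ℝ)..σ, Complex.exp (m * s) * (2 * (σ - s))) := by
  obtain ⟨i1, s1⟩ := radial_outer_sum hm hσ
  obtain ⟨i2, s2⟩ := radial_outer_diff hm σ
  obtain ⟨i3, s3⟩ := radial_inner_diff m hσ
  have hun : Ioc 0 σ ∪ Ioi σ = Ioi (0 : ℝ) := Ioc_union_Ioi_eq_Ioi hσ.le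
  have hdisj : Disjoint (Ioc 0 σ) (Ioi σ) := Ioc_disjoint_Ioi le_rfl
  set L : ℝ → ℂ := fun s => Complex.exp (m * s) * ((|s - σ| + (σ - s) : ℝ) : ℂ) with hL
  have hLin : ∀ s ∈ Ioc 0 σ, L s = Complex.exp (m * s) * (2 * (σ - s)) := by
    intro s hs
    simp only [hL]
    rw [abs_of_nonpos (sub_nonpos.2 hs.2)]
    push_cast
    ring
  have hLout : ∀ s ∈ Ioi σ, L s = 0 := by
    intro s hs
    simp only [hL]
    rw [abs_of_pos (sub_pos.2 hs)]
    simp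
  have j1 : IntegrableOn L (Ioc 0 σ) :=
    (Continuous.integrableOn_Icc (by fun_prop)).mono_set Ioc_subset_Icc_self
  have j2 : IntegrableOn L (Ioi σ) :=
    integrableOn_zero.congr_fun (fun s hs => (hLout s hs).symm) measurableSet_Ioi
  have jL : IntegrableOn L (Ioi 0) := hun ▸ j1.union j2
  have vL : ∫ s in Ioi (0 : ℝ), L s
      = ∫ s in (0 : ℝ)..σ, Complex.exp (m * s) * (2 * (σ - s)) := by
    rw [← hun, setIntegral_union hdisj measurableSet_Ioi j1 j2,
      setIntegral_congr_fun measurableSet_Ioc hLin, setIntegral_congr_fun measurableSet_Ioi hLout,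
      intervalIntegral.integral_of_le hσ.le]
    simp
  have i23 := i3.union i2
  rw [hun] at i23
  have v23 := setIntegral_union hdisj measurableSet_Ioi i3 i2
  rw [hun] at v23
  have hae : ∀ᵐ s : ℝ ∂volume.restrict (Ioi (0 : ℝ)), Complex.exp (m * s)
      * ((Real.log |Real.cosh s ^ 2 - Real.cosh σ ^ 2| - (2 * s - Real.log 4) : ℝ) : ℂ)
      = (L s + Complex.exp (m * s) * ((Real.log (1 - Real.exp (-2 * (s + σ))) : ℝ) : ℂ))
        + Complex.exp (m * s) * ((Real.log (1 - Real.exp (-2 * |s - σ|)) : ℝ) : ℂ) := by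
    rw [ae_restrict_iff' measurableSet_Ioi]
    filter_upwards [Measure.ae_ne volume σ] with s hne hs
    rw [log_cosh_sq_sub_cosh_sq hs hσ hne]
    simp only [hL]
    push_cast
    ring
  refine ⟨((jL.add i1).add i23).congr (hae.mono fun s hs => hs.symm), ?_⟩
  have hint : ∫ s in Ioi (0 : ℝ), Complex.exp (m * s)
      * ((Real.log |Real.cosh s ^ 2 - Real.cosh σ ^ 2| - (2 * s - Real.log 4) : ℝ) : ℂ)
      = (∫ s in Ioi (0 : ℝ), L s)
        + (∫ s in Ioi (0 : ℝ), Complex.exp (m * s)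
          * ((Real.log (1 - Real.exp (-2 * (s + σ))) : ℝ) : ℂ))
        + ∫ s in Ioi (0 : ℝ), Complex.exp (m * s)
          * ((Real.log (1 - Real.exp (-2 * |s - σ|)) : ℝ) : ℂ) := by
    rw [integral_congr_ae hae]
    exact (integral_add (jL.add i1) i23).trans (congrArg (· + _) (integral_add jL i1))
  rw [hint, vL, v23]
  convert! (s1.add s2).add s3 using 1
  · funext n
    ring
  · ring

/-! ### Algebra matching the angular and radial terms -/

lemma two_mul_succ_sub_ne_zero {m : ℂ} (hm : m.re < 1) (n : ℕ) : 2 * ((n : ℂ) + 1) - m ≠ 0 := by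
  intro h
  have h1 := congrArg Complex.re h
  simp at h1
  linarith [Nat.cast_nonneg (α := ℝ) n]

lemma cosCoeff_identity_succ (m : ℂ) (n : ℕ) :
    (m ^ 2 - 4 * ((n : ℂ) + 1) ^ 2) * cosCoeff m (n + 1)
      = 2 * m * Complex.sin (m * (Real.pi / 2)) * (-1) ^ (n + 1) := by
  have h := cosCoeff_identity m (n + 1)
  push_cast at h
  exact h

lemma neg_one_pow_mul_self (n : ℕ) : ((-1 : ℂ) ^ n) * (-1) ^ n = 1 := by
  rw [← mul_pow]
  simp

/-- The fixed radial prefactor is rewritten with a different `c_n` in each term, so that both series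
are expressed in the same coefficients. -/
lemma sin_mul_eq (m : ℂ) (n : ℕ) :
    m * Complex.sin (m * (Real.pi / 2))
      = (-1) ^ (n + 1) * ((m ^ 2 - 4 * ((n : ℂ) + 1) ^ 2) * cosCoeff m (n + 1)) / 2 := by
  rw [cosCoeff_identity_succ]
  linear_combination -m * Complex.sin (m * (Real.pi / 2)) * neg_one_pow_mul_self (n + 1)

/-- As `m² - 4N² = -w(m + 2N)`, the denominator `w` cancels and the bracket is `-m + (m + 2N) = 2N`.
-/
lemma angle_term {m N w e c C : ℂ} (hN : N ≠ 0) (hw : w ≠ 0) (hm : m = 2 * N - w)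
    (he : e * e = 1) :
    m * (-(1 / N) * (C * c)) + e * ((m ^ 2 - 4 * N ^ 2) * c) / 2 * (-2 * e * C / N * (1 / w))
      = 2 * (c * C) := by
  subst hm
  field_simp
  linear_combination w * (4 * N - w) * C * c * he

/-- The factor `m + 2N` left after cancelling `w` is absorbed by `D` through `hD`, so it may vanish.
All terms in `E` then cancel. -/
lemma point_term {m N w e c E X D : ℂ} (hN : N ≠ 0) (hw : w ≠ 0) (hm : m = 2 * N - w)
    (hD : (m + 2 * N) * D = X - E) :
    m * (-(e * E / N) * c) + e * ((m ^ 2 - 4 * N ^ 2) * c) / 2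
      * (-E / N * (1 / w) - X / N * (1 / w) - D / N) = X * (2 * (c * e)) := by
  subst hm
  field_simp
  linear_combination e * c * w ^ 2 * hD

lemma angle_total {m A B S P c l : ℂ} (hm : m ≠ 0) (hc : c = 2 * S / m)
    (key : m * A + m * S * B = P - c) :
    m * (A - l * c) + m * S * B - P = -S * (2 * l + 2 / m) := by
  subst hc
  field_simp at key ⊢
  linear_combination key

lemma point_total {m A B J S P X c l σ : ℂ} (hm : m ≠ 0) (hc : c = 2 * S / m)
    (hJ : m ^ 2 * J = 2 * (X - 1 - m * σ)) (key : m * A + m * S * (B - J) = X * (P - c)) :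
    m * (A + (σ - l) * c) + m * S * B - P * X = -S * (2 * l + 2 / m) := by
  subst hc
  field_simp at key ⊢
  linear_combination key + S * hJ

/-! ### The identity in normalized variables -/

lemma normalized_value_angle {m : ℂ} (hm : m.re < 1) (hm0 : m ≠ 0) {φ : ℝ}
    (hφ : φ ∈ Ioo (-(Real.pi / 2)) (Real.pi / 2)) :
    m * (∫ ψ in (-(Real.pi / 2))..(Real.pi / 2),
        Complex.cos (m * ψ) * ((Real.log |Real.sin φ + Real.sin ψ| : ℝ) : ℂ))
      + m * Complex.sin (m * (Real.pi / 2)) * (∫ s in Ioi (0 : ℝ), Complex.exp (m * s)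
        * ((Real.log |Real.cosh s ^ 2 - Real.sin φ ^ 2| - (2 * s - Real.log 4) : ℝ) : ℂ))
      - Real.pi * Complex.cos (m * φ)
      = -Complex.sin (m * (Real.pi / 2)) * (2 * Real.log 2 + 2 / m) := by
  have h1 := (hasSum_integral_cos_mul_log_two_mul_sin m φ).mul_left m
  have h2 := (radial_angle hm φ).2.mul_left (m * Complex.sin (m * (Real.pi / 2)))
  have h3 := hasSum_cosCoeff m (Ioo_subset_Icc_self hφ)
  have key := (h1.add h2).unique (h3.congr_fun fun n => by
    have hne := two_mul_succ_sub_ne_zero hm n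
    have hn : (n : ℂ) + 1 ≠ 0 := by exact_mod_cast Nat.succ_ne_zero n
    have hsq := neg_one_pow_mul_self (n + 1)
    rw [sin_mul_eq m n]
    exact angle_term hn hne (sub_sub_cancel _ _).symm hsq)
  rw [integral_cos_mul_log_sin_add_sin]
  exact angle_total hm0 (cosCoeff_zero m hm0) key

lemma normalized_value_point {m : ℂ} (hm : m.re < 1) (hm0 : m ≠ 0) {σ : ℝ} (hσ : 0 < σ) :
    m * (∫ ψ in (-(Real.pi / 2))..(Real.pi / 2),
        Complex.cos (m * ψ) * ((Real.log |Real.cosh σ + Real.sin ψ| : ℝ) : ℂ))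
      + m * Complex.sin (m * (Real.pi / 2)) * (∫ s in Ioi (0 : ℝ), Complex.exp (m * s)
        * ((Real.log |Real.cosh s ^ 2 - Real.cosh σ ^ 2| - (2 * s - Real.log 4) : ℝ) : ℂ))
      - Real.pi * Complex.cos (m * (Real.pi / 2)) * Complex.exp (m * σ)
      = -Complex.sin (m * (Real.pi / 2)) * (2 * Real.log 2 + 2 / m) := by
  have hr : |(-Real.exp (-2 * σ))| < 1 := by
    rw [abs_neg, abs_of_pos (Real.exp_pos _), Real.exp_lt_one_iff]
    linarith
  have h1 := (hasSum_integral_cos_mul_log hr m 0).mul_left m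
  have h2 := (radial_point hm hσ).2.mul_left (m * Complex.sin (m * (Real.pi / 2)))
  -- At `π/2` the modes equal `(-1)^n`, matching the signs from `r = -e^{-2σ}`, and the sum supplies
  -- the term `π cos(mπ/2) e^{mσ}`.
  have h3 := (hasSum_cosCoeff m (φ := Real.pi / 2)
    ⟨by linarith [Real.pi_pos], le_rfl⟩).mul_left (Complex.exp (m * σ))
  have key := (h1.add h2).unique (h3.congr_fun fun n => by
    have hne := two_mul_succ_sub_ne_zero hm n
    have hn : (n : ℂ) + 1 ≠ 0 := by exact_mod_cast Nat.succ_ne_zero n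
    have hD := innerCoeff_identity m σ (n + 1)
    have hcos : Complex.cos (2 * (n + 1) * (Real.pi / 2 : ℝ)) = (-1) ^ (n + 1) := by
      rw [show (2 * (n + 1) * (Real.pi / 2 : ℝ) : ℂ) = ((n + 1 : ℕ) : ℂ) * Real.pi by
        push_cast; ring]
      exact_mod_cast congrArg Complex.ofReal (Real.cos_nat_mul_pi (n + 1))
    have hexp : ((-Real.exp (-2 * σ) : ℝ) : ℂ) ^ (n + 1)
        = (-1) ^ (n + 1) * Complex.exp (-2 * (n + 1) * σ) := by
      rw [Complex.ofReal_neg, neg_pow, Complex.ofReal_exp, ← Complex.exp_nat_mul]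
      push_cast
      ring_nf
    push_cast at hD
    rw [sin_mul_eq m n, hcos, hexp]
    simp only [Complex.ofReal_zero, mul_zero, Complex.cos_zero, one_mul]
    have ht := point_term (e := (-1) ^ (n + 1)) (c := cosCoeff m (n + 1)) hn hne
      (sub_sub_cancel _ _).symm hD
    exact ht)
  rw [integral_cos_mul_log_cosh_add_sin m hσ]
  rw [show ((Real.pi / 2 : ℝ) : ℂ) = Real.pi / 2 by push_cast; rfl] at key
  exact point_total hm0 (cosCoeff_zero m hm0) (integral_exp_mul_linear m σ) key

/-! ### Change of variables back to the wedge -/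

/-- The substitution `r = a exp (s / b)` on the half-line `r > a`. -/
lemma log_substitution {a b : ℝ} (ha : 0 < a) (hb : 0 < b) {h g : ℝ → ℂ}
    (hgh : ∀ s ∈ Ioi (0 : ℝ), ((a * Real.exp (s / b) : ℝ) : ℂ) * h (a * Real.exp (s / b)) = g s)
    (hg : IntegrableOn g (Ioi 0)) :
    IntegrableOn h (Ioi a) ∧ ∫ r in Ioi a, h r = (b : ℂ)⁻¹ * ∫ s in Ioi (0 : ℝ), g s := by
  set f : ℝ → ℝ := fun s => a * Real.exp (s / b) with hf
  have himg : f '' Ioi 0 = Ioi a := by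
    ext r
    constructor
    · rintro ⟨s, hs, rfl⟩
      have : 1 < Real.exp (s / b) := Real.one_lt_exp_iff.2 (div_pos hs hb)
      exact lt_mul_of_one_lt_right ha this
    · intro hr
      have hr1 : 1 < r / a := (one_lt_div ha).2 hr
      refine ⟨b * Real.log (r / a), mul_pos hb (Real.log_pos hr1), ?_⟩
      simp only [hf]
      rw [mul_div_cancel_left₀ _ hb.ne', Real.exp_log (by linarith), mul_div_cancel₀ _ ha.ne']
  have hderiv : ∀ s ∈ Ioi (0 : ℝ), HasDerivWithinAt f (a * Real.exp (s / b) / b) (Ioi 0) s := by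
    intro s _
    refine ((((hasDerivAt_id' s).div_const b).exp.const_mul a).congr_deriv ?_).hasDerivWithinAt
    ring
  have hinj : InjOn f (Ioi 0) := by
    intro s _ t _ hst
    have h1 := Real.exp_injective (mul_left_cancel₀ ha.ne' hst)
    field_simp at h1
    exact h1
  have hval : ∀ s ∈ Ioi (0 : ℝ), |a * Real.exp (s / b) / b| • h (f s) = (b : ℂ)⁻¹ * g s := by
    intro s hs
    rw [← hgh s hs, abs_of_pos (by positivity), Complex.real_smul]
    push_cast
    ring
  rw [← himg, integrableOn_image_iff_integrableOn_abs_deriv_smul measurableSet_Ioi hderiv hinj,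
    integral_image_eq_integral_abs_deriv_smul measurableSet_Ioi hderiv hinj,
    setIntegral_congr_fun measurableSet_Ioi hval, integral_const_mul]
  exact ⟨IntegrableOn.congr_fun (hg.const_mul _) (fun s hs => (hval s hs).symm) measurableSet_Ioi,
    rfl⟩

lemma angular_substitution {b α : ℝ} (hb : b ≠ 0) {f h : ℝ → ℂ} (hfh : ∀ θ, h θ = f (b * θ))
    (hf : IntervalIntegrable f volume (-(b * α)) (b * α)) :
    IntervalIntegrable h volume (-α) α ∧
      ∫ θ in (-α)..α, h θ = (b : ℂ)⁻¹ * ∫ ψ in (-(b * α))..(b * α), f ψ := by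
  obtain rfl : h = fun θ => f (b * θ) := funext hfh
  constructor
  · have h1 := hf.comp_mul_left (c := b)
    rwa [neg_div, mul_div_cancel_left₀ _ hb] at h1
  · rw [intervalIntegral.integral_comp_mul_left _ hb, mul_neg, Complex.real_smul]
    push_cast
    rfl

lemma R_exp {a α : ℝ} (ha : 0 < a) (hα : 0 < α) (s : ℝ) :
    R a α (a * Real.exp (s / (Real.pi / (2 * α)))) = 2 * Real.cosh s := by
  have hb : Real.pi / (2 * α) ≠ 0 := by positivity
  rw [R, mul_div_cancel_left₀ _ ha.ne', ← Real.exp_mul, ← Real.exp_mul, mul_neg,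
    div_mul_cancel₀ _ hb, Real.cosh_eq]
  ring

lemma G_exp {a α : ℝ} (ha : 0 < a) (hα : 0 < α) (s : ℝ) :
    G a α (a * Real.exp (s / (Real.pi / (2 * α)))) = 2 * s - Real.log 4 := by
  have := Real.pi_pos.ne'
  rw [G, mul_div_cancel_left₀ _ ha.ne', Real.log_exp]
  field_simp

lemma ratio_cpow {a b : ℝ} (ha : 0 < a) (hb : b ≠ 0) (m : ℂ) (s : ℝ) :
    ((a * Real.exp (s / b) / a : ℝ) : ℂ) ^ (b * m) = Complex.exp (m * s) := by
  have hb' : (b : ℂ) ≠ 0 := by exact_mod_cast hb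
  rw [mul_div_cancel_left₀ _ ha.ne', Complex.ofReal_exp, Complex.cpow_def_of_ne_zero
    (Complex.exp_ne_zero _), ← Complex.ofReal_exp, ← Complex.ofReal_log (Real.exp_nonneg _),
    Real.log_exp]
  congr 1
  push_cast
  field_simp

end NeumannWedge

theorem proposition4p1 (a α : ℝ) (ha : 0 < a) (hα : 0 < α)
    (κ k : ℂ) (hκ : -1 < κ.re) (hk : k = -(Real.pi * κ / (2 * α))) :
    -- all the integrals converge absolutely
    (∀ φ ∈ Ioo (-α) α,
      IntervalIntegrable (NeumannWedge.angular₁ α φ k) volume (-α) α ∧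
      IntegrableOn (NeumannWedge.radial₁ a α φ k) (Ioi a)) ∧
    (∀ ρ ∈ Ioi a,
      IntervalIntegrable (NeumannWedge.angular₂ a α ρ k) volume (-α) α ∧
      IntegrableOn (NeumannWedge.radial₂ a α ρ k) (Ioi a)) ∧
    -- the value for nonzero `k`
    (k ≠ 0 →
      (∀ φ ∈ Ioo (-α) α, NeumannWedge.F₁ a α φ k =
        -Complex.sin (α * k) * (2 * Real.log 2 + Real.pi / (α * k))) ∧
      (∀ ρ ∈ Ioi a, NeumannWedge.F₂ a α ρ k =
        -Complex.sin (α * k) * (2 * Real.log 2 + Real.pi / (α * k)))) ∧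
    -- the value at `k = 0`, where the formula is read as its limit
    (k = 0 →
      (∀ φ ∈ Ioo (-α) α, NeumannWedge.F₁ a α φ k = -Real.pi) ∧
      (∀ ρ ∈ Ioi a, NeumannWedge.F₂ a α ρ k = -Real.pi)) := by
  open NeumannWedge in
  have hpi := Real.pi_pos
  set b : ℝ := Real.pi / (2 * α) with hbdef
  have hb : 0 < b := by positivity
  have hbα : b * α = Real.pi / 2 := by rw [hbdef]; field_simp
  have hbc : (b : ℂ) ≠ 0 := by exact_mod_cast hb.ne'
  have hαc : (α : ℂ) ≠ 0 := by exact_mod_cast hα.ne'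
  have hpic : (Real.pi : ℂ) ≠ 0 := by exact_mod_cast hpi.ne'
  -- The normalized exponent is `m = k/b`; the hypothesis on `κ` becomes `Re m < 1`.
  obtain ⟨m, hmκ⟩ : ∃ m : ℂ, m = -κ := ⟨_, rfl⟩
  have hm : m.re < 1 := by rw [hmκ, Complex.neg_re]; linarith
  have hkm : k = b * m := by
    rw [hk, hmκ, hbdef]
    push_cast
    ring
  have hαk : α * k = m * (Real.pi / 2) := by
    rw [hkm, ← mul_assoc, mul_comm (α : ℂ), ← Complex.ofReal_mul, hbα]
    push_cast
    ring
  have hangle : ∀ θ : ℝ, Real.pi * θ / (2 * α) = b * θ := fun θ => by rw [hbdef]; ring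
  have hkθ : ∀ θ : ℝ, k * θ = m * ((b * θ : ℝ) : ℂ) := fun θ => by rw [hkm]; push_cast; ring
  have hA₁ : ∀ φ : ℝ, IntervalIntegrable (angular₁ α φ k) volume (-α) α ∧
      ∫ θ in (-α)..α, angular₁ α φ k θ = (b : ℂ)⁻¹ * ∫ ψ in (-(Real.pi / 2))..(Real.pi / 2),
        Complex.cos (m * ψ) * ((Real.log |Real.sin (b * φ) + Real.sin ψ| : ℝ) : ℂ) := by
    intro φ
    rw [← hbα]
    refine angular_substitution hb.ne' (fun θ => ?_)
      (intervalIntegrable_cos_mul m (intervalIntegrable_log_sin_add_sin (b * φ) _ _))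
    rw [angular₁, hangle, hangle, hkθ]
  have hR₁ : ∀ φ : ℝ, IntegrableOn (radial₁ a α φ k) (Ioi a) ∧
      ∫ r in Ioi a, radial₁ a α φ k r = (b : ℂ)⁻¹ * ∫ s in Ioi (0 : ℝ), Complex.exp (m * s)
        * ((Real.log |Real.cosh s ^ 2 - Real.sin (b * φ) ^ 2| - (2 * s - Real.log 4) : ℝ) : ℂ) := by
    intro φ
    refine log_substitution ha hb (fun s _ => ?_) (radial_angle hm (b * φ)).1
    have hne : ((a * Real.exp (s / b) : ℝ) : ℂ) ≠ 0 := by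
      exact_mod_cast (mul_pos ha (Real.exp_pos _)).ne'
    rw [radial₁, hangle, R_exp ha hα, G_exp ha hα, hkm, ratio_cpow ha hb.ne',
      mul_div_cancel₀ _ hne, show (2 * Real.cosh s) ^ 2 / 4 = Real.cosh s ^ 2 by ring]
  have hρ : ∀ ρ ∈ Ioi a, ∃ σ : ℝ, 0 < σ ∧ ρ = a * Real.exp (σ / b) := by
    intro ρ hρ
    have hr1 : 1 < ρ / a := (one_lt_div ha).2 hρ
    refine ⟨b * Real.log (ρ / a), mul_pos hb (Real.log_pos hr1), ?_⟩
    rw [mul_div_cancel_left₀ _ hb.ne', Real.exp_log (by linarith), mul_div_cancel₀ _ ha.ne']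
  have hA₂ : ∀ σ : ℝ, IntervalIntegrable (angular₂ a α (a * Real.exp (σ / b)) k) volume (-α) α ∧
      ∫ θ in (-α)..α, angular₂ a α (a * Real.exp (σ / b)) k θ
        = (b : ℂ)⁻¹ * ∫ ψ in (-(Real.pi / 2))..(Real.pi / 2),
        Complex.cos (m * ψ) * ((Real.log |Real.cosh σ + Real.sin ψ| : ℝ) : ℂ) := by
    intro σ
    rw [← hbα]
    refine angular_substitution hb.ne' (fun θ => ?_)
      (intervalIntegrable_cos_mul m (intervalIntegrable_log_cosh_add_sin σ _ _))
    rw [angular₂, hangle, hkθ, R_exp ha hα, mul_div_cancel_left₀ _ two_ne_zero]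
  have hR₂ : ∀ σ : ℝ, 0 < σ → IntegrableOn (radial₂ a α (a * Real.exp (σ / b)) k) (Ioi a) ∧
      ∫ r in Ioi a, radial₂ a α (a * Real.exp (σ / b)) k r
        = (b : ℂ)⁻¹ * ∫ s in Ioi (0 : ℝ), Complex.exp (m * s)
        * ((Real.log |Real.cosh s ^ 2 - Real.cosh σ ^ 2| - (2 * s - Real.log 4) : ℝ) : ℂ) := by
    intro σ hσ
    refine log_substitution ha hb (fun s _ => ?_) (radial_point hm hσ).1
    have hne : ((a * Real.exp (s / b) : ℝ) : ℂ) ≠ 0 := by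
      exact_mod_cast (mul_pos ha (Real.exp_pos _)).ne'
    have hsq : ∀ t : ℝ, (2 * Real.cosh t) ^ 2 / 4 = Real.cosh t ^ 2 := fun t => by ring
    rw [radial₂, R_exp ha hα, R_exp ha hα, G_exp ha hα, hkm, ratio_cpow ha hb.ne',
      mul_div_cancel₀ _ hne, hsq, hsq]
  -- At `k = 0` both integrals carry a factor `k`, so only the last term of each function remains.
  refine ⟨fun φ _ => ⟨(hA₁ φ).1, (hR₁ φ).1⟩, fun ρ hρa => ?_, fun hk0 => ⟨fun φ hφ => ?_,
    fun ρ hρa => ?_⟩, fun hk0 => ⟨fun φ _ => by simp [F₁, hk0], fun ρ _ => by simp [F₂, hk0]⟩⟩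
  · obtain ⟨σ, hσ, rfl⟩ := hρ ρ hρa
    exact ⟨(hA₂ σ).1, (hR₂ σ hσ).1⟩
  · have hm0 : m ≠ 0 := fun h => hk0 (by rw [hkm, h, mul_zero])
    have hφ' : b * φ ∈ Ioo (-(Real.pi / 2)) (Real.pi / 2) := by
      rw [← hbα, ← mul_neg]
      exact ⟨mul_lt_mul_of_pos_left hφ.1 hb, mul_lt_mul_of_pos_left hφ.2 hb⟩
    have hv := normalized_value_angle hm hm0 hφ'
    rw [F₁, (hA₁ φ).2, (hR₁ φ).2, hαk, hkθ,
      show (Real.pi / (m * (Real.pi / 2)) : ℂ) = 2 / m by field_simp, ← hv, hkm]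
    field_simp
  · have hm0 : m ≠ 0 := fun h => hk0 (by rw [hkm, h, mul_zero])
    obtain ⟨σ, hσ, rfl⟩ := hρ ρ hρa
    have hv := normalized_value_point hm hm0 hσ
    rw [F₂, (hA₂ σ).2, (hR₂ σ hσ).2, hαk,
      show (Real.pi / (m * (Real.pi / 2)) : ℂ) = 2 / m by field_simp, ← hv, hkm,
      ratio_cpow ha hb.ne']
    field_simp
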